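/- Let $G=(V,E)$ be a finite simple undirected graph with $n$ vertices and $m$ edges, with adjacency matrix $A$ and diagonal degree matrix $D$. Let $B$ be its non-backtracking matrix, i.e. the $2m\times 2m$ matrix indexed by the directed edges $(u,v)$, $u\sim v$, of $G$ with $$B((u,v),(x,y))=\begin{cases}1 & \text{if } v=x \text{ and } u\neq y,\\ 0 & \text{otherwise,}\end{cases}$$ and let $K$ be the $2n\times 2n$ block matrix $$K=\begin{bmatrix}A & D-I\\ -I & 0\end{bmatrix}.$$ Write $\rho(M)$ for the spectral radius of a square matrix $M$, the largest modulus of a complex eigenvalue of $M$. If $G$ is connected, is neither a tree nor a cycle (a graph isomorphic to $C_k$ for some $k\ge 3$), and has minimum degree $d_{\min}\ge 2$, then $$\rho(K)=\rho(B)>1.$$ -/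

import Mathlib

namespace NonBacktracking

/-- The non-backtracking matrix `B`, indexed by the directed edges (darts) of `G`:
`B((u,v),(x,y)) = 1` if `v = x` and `u ≠ y`, and `0` otherwise. -/
def matrixB {V : Type*} [DecidableEq V] (G : SimpleGraph V) :
    Matrix G.Dart G.Dart ℂ :=
  Matrix.of fun e f => if e.snd = f.fst ∧ e.fst ≠ f.snd then 1 else 0

/-- The `2n × 2n` block matrix `K = [[A, D - I], [-I, 0]]`, with `A` the adjacency matrix and
`D` the degree matrix of `G`. -/
def matrixK {V : Type*} [Fintype V] [DecidableEq V] (G : SimpleGraph V) [DecidableRel G.Adj] :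
    Matrix (V ⊕ V) (V ⊕ V) ℂ :=
  Matrix.fromBlocks (G.adjMatrix ℂ) (G.degMatrix ℂ - 1) (-1) 0

/-- `G` is a cycle: it is isomorphic to the cycle graph `C_n` for some `n ≥ 3`. -/
def IsCycleGraph {V : Type*} (G : SimpleGraph V) : Prop :=
  ∃ n : ℕ, 3 ≤ n ∧ Nonempty (G ≃g SimpleGraph.cycleGraph n)

end NonBacktracking

/-!
Away from `μ = ±1`, the matrices `K` and `B` have the same eigenvalues. An eigenvector of `K` for
`μ` has the form `(-μ x, x)` with `(μ² - μ A + (D - I)) x = 0`, and for `μ² ≠ 1` the nonzero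
solutions `x` of this quadratic problem correspond to eigenvectors of `B`: `x` gives the function
`(u, v) ↦ μ x v - x u` on darts, and `x` is recovered, up to the factor `μ² - 1`, by summing over
the darts leaving a vertex (`mem_spectrum_matrixK_iff`, `mem_spectrum_matrixB_iff`). In
particular the two spectra agree outside the closed unit disc, so the spectral radii are equal as
soon as one of them exceeds `1`.

Up to sign, `det K = ∏ u, (d u - 1)`, which is at least `2` when all degrees are at least `2` and
one of them is larger; hence `K` has an eigenvalue of modulus greater than `1`
(`one_lt_norm_det_matrixK`, `one_lt_spectralRadius_of_one_lt_norm_det`). The remaining case, in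
which every degree is `2`, is excluded because a connected 2-regular graph is a cycle
(`isCycleGraph_of_degree_eq_two`).
-/

namespace NonBacktracking

open Matrix SimpleGraph

variable {V : Type*}

/-! ### Spectra of complex matrices -/

lemma mem_spectrum_iff_exists_mulVec {n : Type*} [Fintype n] [DecidableEq n]
    (M : Matrix n n ℂ) (μ : ℂ) :
    μ ∈ spectrum ℂ M ↔ ∃ x : n → ℂ, x ≠ 0 ∧ M *ᵥ x = μ • x := by
  rw [← spectrum_toLin', ← Module.End.hasEigenvalue_iff_mem_spectrum]
  constructor
  · intro h
    obtain ⟨x, hx⟩ := h.exists_hasEigenvector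
    exact ⟨x, hx.2, by simpa using hx.apply_eq_smul⟩
  · rintro ⟨x, hx, h⟩
    exact Module.End.hasEigenvalue_of_hasEigenvector
      ⟨Module.End.mem_eigenspace_iff.2 (by simpa using h), hx⟩

/-- The determinant is the product of the eigenvalues, so one of them exceeds `1` in modulus as
soon as the determinant does. -/
lemma one_lt_spectralRadius_of_one_lt_norm_det {n : Type*} [Fintype n] [DecidableEq n]
    (M : Matrix n n ℂ) (h : 1 < ‖M.det‖) : 1 < spectralRadius ℂ M := by
  by_contra! hle
  have hroot : ∀ z ∈ M.charpoly.roots, ‖z‖₊ ≤ 1 := fun z hz => by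
    have hz' : z ∈ spectrum ℂ M :=
      mem_spectrum_iff_isRoot_charpoly.2 (Polynomial.isRoot_of_mem_roots hz)
    exact_mod_cast (le_iSup₂ (f := fun (k : ℂ) (_ : k ∈ spectrum ℂ M) => (‖k‖₊ : ENNReal))
      z hz').trans hle
  have hprod : ∀ s : Multiset ℂ, (∀ z ∈ s, ‖z‖₊ ≤ 1) → ‖s.prod‖₊ ≤ 1 := fun s => by
    induction s using Multiset.induction with
    | empty => simp
    | cons a s ih =>
      intro hs
      rw [Multiset.prod_cons, nnnorm_mul]
      exact mul_le_one' (hs a (by simp)) (ih fun z hz => hs z (by simp [hz]))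
  have := hprod _ hroot
  rw [← det_eq_prod_roots_charpoly] at this
  exact absurd h (not_lt.2 (by exact_mod_cast this))

/-- Eigenvalues in the closed unit disc are irrelevant for a comparison of spectral radii when the
larger one exceeds `1`. -/
lemma spectralRadius_le_of_forall_one_lt {A B : Type*} [Ring A] [Algebra ℂ A] [Ring B]
    [Algebra ℂ B] {a : A} {b : B} (hb : 1 ≤ spectralRadius ℂ b)
    (h : ∀ z : ℂ, 1 < ‖z‖ → z ∈ spectrum ℂ a → z ∈ spectrum ℂ b) :
    spectralRadius ℂ a ≤ spectralRadius ℂ b := by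
  refine iSup₂_le fun z hz => ?_
  rcases le_or_gt ‖z‖ 1 with hz1 | hz1
  · exact le_trans (by exact_mod_cast hz1) hb
  · exact le_iSup₂ (f := fun (k : ℂ) (_ : k ∈ spectrum ℂ b) => (‖k‖₊ : ENNReal)) z (h z hz1 hz)

/-! ### The quadratic eigenvalue problem behind `K` and `B` -/

section Spectra

variable [Fintype V] [DecidableEq V] (G : SimpleGraph V) [DecidableRel G.Adj]

/-- The vector `x` lies in the kernel of `μ² - μ A + (D - I)`. -/
def IsQuadraticEigenvector (μ : ℂ) (x : V → ℂ) : Prop :=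
  ∀ u, μ ^ 2 * x u - μ * ∑ v ∈ G.neighborFinset u, x v + (G.degree u - 1) * x u = 0

lemma matrixK_mulVec_elim (x y : V → ℂ) :
    matrixK G *ᵥ Sum.elim x y =
      Sum.elim (fun u => ∑ v ∈ G.neighborFinset u, x v + (G.degree u - 1) * y u) (-x) := by
  ext (u | u)
  · simp [matrixK, fromBlocks_mulVec, sub_mulVec, degMatrix, mulVec_diagonal, sub_mul,
      adjMatrix_mulVec_apply]
  · simp [matrixK, fromBlocks_mulVec, neg_mulVec]

lemma mem_spectrum_matrixK_iff (μ : ℂ) :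
    μ ∈ spectrum ℂ (matrixK G) ↔ ∃ x : V → ℂ, x ≠ 0 ∧ IsQuadraticEigenvector G μ x := by
  rw [mem_spectrum_iff_exists_mulVec]
  constructor
  · rintro ⟨z, hz, h⟩
    obtain ⟨x, y, rfl⟩ : ∃ x y : V → ℂ, z = Sum.elim x y :=
      ⟨z ∘ Sum.inl, z ∘ Sum.inr, (Sum.elim_comp_inl_inr z).symm⟩
    rw [matrixK_mulVec_elim] at h
    have hx : x = fun v => -(μ * y v) := funext fun v => by
      have := congrFun h (Sum.inr v)
      simp only [Sum.elim_inr, Pi.neg_apply, Pi.smul_apply, smul_eq_mul] at this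
      rw [← this, neg_neg]
    refine ⟨y, ?_, fun u => ?_⟩
    · rintro rfl
      exact hz (funext fun i => by rcases i with i | i <;> simp [hx])
    · have := congrFun h (Sum.inl u)
      simp only [hx, Sum.elim_inl, Pi.smul_apply, smul_eq_mul, Finset.sum_neg_distrib,
        ← Finset.mul_sum] at this
      linear_combination this
  · rintro ⟨x, hx, h⟩
    refine ⟨Sum.elim (fun v => -(μ * x v)) x, fun h0 => hx (funext fun v => ?_), ?_⟩
    · simpa using congrFun h0 (Sum.inr v)
    · rw [matrixK_mulVec_elim]
      ext (u | u)
      · simp only [Sum.elim_inl, Pi.smul_apply, smul_eq_mul, Finset.sum_neg_distrib,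
          ← Finset.mul_sum]
        linear_combination h u
      · simp

/-- The sum of a function on darts over the darts leaving `u`. -/
def outSum (f : G.Dart → ℂ) (u : V) : ℂ := ∑ d : G.Dart, if d.fst = u then f d else 0

variable {G}

lemma outSum_eq_sum_neighborFinset {f : G.Dart → ℂ} {u : V} {h : V → ℂ}
    (hf : ∀ d : G.Dart, d.fst = u → f d = h d.snd) :
    outSum G f u = ∑ v ∈ G.neighborFinset u, h v := by
  rw [outSum, ← Finset.sum_filter]
  refine Finset.sum_bij (fun d _ => d.snd) ?_ ?_ ?_ ?_
  · intro d hd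
    rw [← (Finset.mem_filter.1 hd).2, mem_neighborFinset]
    exact d.adj
  · intro d hd e he hde
    exact Dart.ext _ _ (Prod.ext ((Finset.mem_filter.1 hd).2.trans
      (Finset.mem_filter.1 he).2.symm) hde)
  · intro v hv
    exact ⟨⟨(u, v), (mem_neighborFinset _ _ _).1 hv⟩, by simp, rfl⟩
  · intro d hd
    exact hf d (Finset.mem_filter.1 hd).2

lemma matrixB_mulVec_apply (f : G.Dart → ℂ) (e : G.Dart) :
    (matrixB G *ᵥ f) e = outSum G f e.snd - f e.symm := by
  have hsymm : f e.symm = ∑ d : G.Dart, if d = e.symm then f d else 0 := by simp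
  rw [hsymm, outSum, ← Finset.sum_sub_distrib]
  refine Finset.sum_congr rfl fun d _ => ?_
  have hd : d = e.symm ↔ d.fst = e.snd ∧ d.snd = e.fst := by
    rw [Dart.ext_iff, Prod.ext_iff]; rfl
  simp only [matrixB, of_apply, hd]
  by_cases h1 : d.fst = e.snd <;> by_cases h2 : d.snd = e.fst <;>
    simp [h1, h2, eq_comm (a := e.snd), eq_comm (a := e.fst)]

/-- A quadratic eigenvector `x` yields the eigenvector `(u, v) ↦ μ x v - x u` of `B`, and an
eigenvector `f` of `B` yields its vector of sums over outgoing darts. Both maps preserve being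
nonzero when `μ² ≠ 1` and `G` has no isolated vertex. -/
lemma mem_spectrum_matrixB_iff (hG : ∀ u, ∃ v, G.Adj u v) {μ : ℂ} (hμ : μ ^ 2 ≠ 1) :
    μ ∈ spectrum ℂ (matrixB G) ↔ ∃ x : V → ℂ, x ≠ 0 ∧ IsQuadraticEigenvector G μ x := by
  rw [mem_spectrum_iff_exists_mulVec]
  constructor
  · rintro ⟨f, hf, h⟩
    have key : ∀ e : G.Dart, outSum G f e.snd - f e.symm = μ * f e := fun e => by
      rw [← matrixB_mulVec_apply, h, Pi.smul_apply, smul_eq_mul]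
    -- Eliminating `f e.symm` between the equations at `e` and `e.symm` expresses `f` by its sums.
    have hfe : ∀ e : G.Dart, (μ ^ 2 - 1) * f e = μ * outSum G f e.snd - outSum G f e.fst :=
      fun e => by
        have h2 := key e.symm
        rw [Dart.symm_symm] at h2
        change outSum G f e.fst - f e = _ at h2
        linear_combination (-μ) * key e + h2
    have hμ' : μ ^ 2 - 1 ≠ 0 := sub_ne_zero.2 hμ
    refine ⟨outSum G f, fun h0 => hf (funext fun e => ?_), fun u => ?_⟩
    · simpa [h0, hμ'] using hfe e
    · have hsum : (μ ^ 2 - 1) * outSum G f u =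
          outSum G (fun e => (μ ^ 2 - 1) * f e) u := by
        simp only [outSum, Finset.mul_sum, mul_ite, mul_zero]
      rw [outSum_eq_sum_neighborFinset (f := fun e => (μ ^ 2 - 1) * f e)
        (h := fun v => μ * outSum G f v - outSum G f u) (fun d hd => by rw [hfe, hd]), Finset.sum_sub_distrib, ← Finset.mul_sum,
        Finset.sum_const, card_neighborFinset_eq_degree, nsmul_eq_mul] at hsum
      linear_combination hsum
  · rintro ⟨x, hx, h⟩
    refine ⟨fun e => μ * x e.snd - x e.fst, fun h0 => hx (funext fun u => ?_),
      funext fun e => ?_⟩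
    · obtain ⟨v, huv⟩ := hG u
      have h1 : μ * x v - x u = 0 := congrFun h0 ⟨(u, v), huv⟩
      have h2 : μ * x u - x v = 0 := congrFun h0 ⟨(v, u), huv.symm⟩
      have h3 : (μ ^ 2 - 1) * x u = 0 := by linear_combination μ * h2 + h1
      exact (mul_eq_zero.1 h3).resolve_left (sub_ne_zero.2 hμ)
    · rw [matrixB_mulVec_apply,
        outSum_eq_sum_neighborFinset (h := fun w => μ * x w - x e.snd)
          (fun d hd => by rw [hd]), Finset.sum_sub_distrib, ← Finset.mul_sum,
        Finset.sum_const, card_neighborFinset_eq_degree, nsmul_eq_mul]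
      change _ - (μ * x e.fst - x e.snd) = μ * (μ * x e.snd - x e.fst)
      linear_combination -h e.snd

/-! ### The determinant of `K` -/

variable (G)

lemma norm_det_matrixK : ‖(matrixK G).det‖ = ∏ u, ‖(G.degree u : ℂ) - 1‖ := by
  have hmul : matrixK G * J V ℂ =
      fromBlocks (diagonal fun u => (G.degree u : ℂ) - 1) (-G.adjMatrix ℂ) 0 1 := by
    have hD : G.degMatrix ℂ - 1 = diagonal fun u => (G.degree u : ℂ) - 1 := by
      rw [degMatrix, ← diagonal_one, diagonal_sub]
    rw [matrixK, J, fromBlocks_multiply, hD]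
    simp
  have hdet := congrArg (fun M => ‖det M‖) hmul
  have hJ : ‖(J V ℂ).det‖ = 1 := by
    have := congrArg norm (J_det_mul_J_det V ℂ)
    rw [norm_mul, norm_one] at this
    nlinarith [norm_nonneg (J V ℂ).det]
  simpa [det_mul, det_fromBlocks_zero₂₁, hJ, norm_prod] using hdet

lemma one_lt_norm_det_matrixK (hdeg : ∀ u, 2 ≤ G.degree u) {w : V} (hw : G.degree w ≠ 2) :
    1 < ‖(matrixK G).det‖ := by
  have hnorm : ∀ u, ‖(G.degree u : ℂ) - 1‖ = ((G.degree u - 1 : ℕ) : ℝ) := fun u => by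
    rw [← Nat.cast_one, ← Nat.cast_sub (by linarith [hdeg u]), Complex.norm_natCast]
  simp only [norm_det_matrixK, hnorm]
  rw [← Nat.cast_prod, Nat.one_lt_cast]
  have hpos : 0 < ∏ u, (G.degree u - 1) := Finset.prod_pos fun u _ => by have := hdeg u; omega
  have hdvd := Finset.dvd_prod_of_mem (fun u => G.degree u - 1) (Finset.mem_univ w)
  have hle := Nat.le_of_dvd hpos hdvd
  have := hdeg w
  omega

end Spectra

/-! ### Connected 2-regular graphs -/

lemma cycleGraph_adj_iff_val {n : ℕ} {i j : Fin n} (hn : 2 ≤ n) :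
    (cycleGraph n).Adj i j ↔
      (i : ℕ) + 1 = j ∨ (j : ℕ) + 1 = i ∨ ((i : ℕ) = 0 ∧ (j : ℕ) + 1 = n) ∨
        ((j : ℕ) = 0 ∧ (i : ℕ) + 1 = n) := by
  have hsub : ∀ a b : Fin n, (a - b).val = 1 ↔ (b : ℕ) + 1 = a ∨ ((a : ℕ) = 0 ∧ (b : ℕ) + 1 = n) :=
    fun a b => by
      have ha := a.2
      have hb := b.2
      rw [Fin.val_sub]
      rcases le_or_gt (b : ℕ) a with h | h
      · rw [show n - (b : ℕ) + a = n + (a - b) by omega, Nat.add_mod_left,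
          Nat.mod_eq_of_lt (by omega)]
        omega
      · rw [Nat.mod_eq_of_lt (by omega)]
        omega
  rw [cycleGraph_adj', hsub, hsub]
  omega

/-- A finite graph all of whose degrees are `2` is a disjoint union of cycles; connectedness
leaves a single closed walk, whose vertices enumerate `V` in cyclic order. -/
lemma isCycleGraph_of_degree_eq_two [Fintype V] (G : SimpleGraph V)
    [DecidableRel G.Adj] (hconn : G.Connected) (hdeg : ∀ u, G.degree u = 2) :
    IsCycleGraph G := by
  classical
  have hcyc : G.IsCycles := fun v _ => by
    rw [← hdeg v, ← card_neighborSet_eq_degree, Set.ncard_eq_toFinset_card', Set.toFinset_card]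
  obtain ⟨v⟩ := hconn.nonempty
  have hne : (G.neighborSet v).Nonempty :=
    (G.degree_pos_iff_exists_adj v).1 (by rw [hdeg]; norm_num)
  obtain ⟨p, hp, hverts⟩ :=
    hcyc.exists_cycle_toSubgraph_verts_eq_connectedComponentSupp
      (c := G.connectedComponentMk v) rfl hne
  have hmem : ∀ u, u ∈ p.toSubgraph.verts := fun u => by
    rw [hverts]
    exact ConnectedComponent.eq.2 (hconn.preconnected u v)
  have hlen := hp.three_le_length
  have hinj : Function.Injective fun i : Fin p.length => p.getVert i := fun i j hij =>
    Fin.ext (hp.getVert_injOn' (by simp only [Set.mem_ofPred_eq]; omega)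
      (by simp only [Set.mem_ofPred_eq]; omega) hij)
  have hsurj : Function.Surjective fun i : Fin p.length => p.getVert i := fun u => by
    obtain ⟨k, hk, hkl⟩ :=
      Walk.mem_support_iff_exists_getVert.1 ((Walk.mem_verts_toSubgraph p).1 (hmem u))
    rcases hkl.lt_or_eq with hlt | rfl
    · exact ⟨⟨k, hlt⟩, hk⟩
    · refine ⟨⟨0, by omega⟩, ?_⟩
      rw [← hk]
      simp
  have hadj : ∀ i j : Fin p.length,
      G.Adj (p.getVert i) (p.getVert j) ↔ (cycleGraph p.length).Adj i j := fun i j => by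
    have hi := i.2
    have hj := j.2
    have hval : ∀ a b, a < p.length → b < p.length →
        (p.getVert a = p.getVert b ↔ a = b) := fun a b ha hb =>
      ⟨fun h => congrArg Fin.val (@hinj ⟨a, ha⟩ ⟨b, hb⟩ h), fun h => by rw [h]⟩
    -- The last edge of the walk returns to its starting vertex.
    have hlast : ∀ k, k + 1 = p.length → p.getVert (k + 1) = p.getVert 0 := fun k hk => by
      rw [hk, p.getVert_length, p.getVert_zero]
    rw [← hp.adj_toSubgraph_iff_of_isCycles hcyc (hmem _), Walk.toSubgraph_adj_iff,
      cycleGraph_adj_iff_val (by omega)]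
    constructor
    · rintro ⟨k, hk, hkl⟩
      rcases Nat.lt_or_ge (k + 1) p.length with hk1 | hk1
      · simp only [Sym2.eq_iff, hval _ _ hkl hi, hval _ _ hkl hj, hval _ _ hk1 hi,
          hval _ _ hk1 hj] at hk
        omega
      · have h0 : 0 < p.length := by omega
        rw [hlast k (by omega)] at hk
        simp only [Sym2.eq_iff, hval _ _ hkl hi, hval _ _ hkl hj, hval _ _ h0 hi,
          hval _ _ h0 hj] at hk
        omega
    · rintro (h | h | ⟨h0, h⟩ | ⟨h0, h⟩)
      · exact ⟨i, by rw [h], hi⟩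
      · exact ⟨j, by rw [h, Sym2.eq_swap], hj⟩
      · exact ⟨j, by rw [hlast _ h, h0, Sym2.eq_swap], hj⟩
      · exact ⟨i, by rw [hlast _ h, h0], hi⟩
  exact ⟨p.length, hlen, ⟨RelIso.symm ⟨Equiv.ofBijective _ ⟨hinj, hsurj⟩, hadj _ _⟩⟩⟩

end NonBacktracking

open NonBacktracking in
theorem mainTheorem9 {V : Type*} [Fintype V] [DecidableEq V] (G : SimpleGraph V)
    [DecidableRel G.Adj] (hconn : G.Connected) (htree : ¬ G.IsTree)
    (hcycle : ¬ NonBacktracking.IsCycleGraph G) (hdeg : 2 ≤ G.minDegree) :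
    spectralRadius ℂ (NonBacktracking.matrixK G) = spectralRadius ℂ (NonBacktracking.matrixB G) ∧
      1 < spectralRadius ℂ (NonBacktracking.matrixK G) := by
  have hdeg' : ∀ u, 2 ≤ G.degree u := fun u => hdeg.trans (G.minDegree_le_degree u)
  obtain ⟨w, hw⟩ : ∃ w, G.degree w ≠ 2 := by
    by_contra! h
    exact hcycle (isCycleGraph_of_degree_eq_two G hconn h)
  have hK := one_lt_spectralRadius_of_one_lt_norm_det _ (one_lt_norm_det_matrixK G hdeg' hw)
  have hadj : ∀ u, ∃ v, G.Adj u v := fun u =>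
    (G.degree_pos_iff_exists_adj u).1 (by linarith [hdeg' u])
  have hspec : ∀ z : ℂ, 1 < ‖z‖ →
      (z ∈ spectrum ℂ (matrixK G) ↔ z ∈ spectrum ℂ (matrixB G)) := fun z hz => by
    have hz2 : z ^ 2 ≠ 1 := fun h => by
      have := congrArg norm h
      rw [norm_pow, norm_one] at this
      nlinarith
    rw [mem_spectrum_matrixK_iff, mem_spectrum_matrixB_iff hadj hz2]
  have hB : 1 < spectralRadius ℂ (matrixB G) := by
    obtain ⟨z, hz⟩ := lt_iSup_iff.1 hK
    obtain ⟨hzK, hz1⟩ := lt_iSup_iff.1 hz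
    exact lt_of_lt_of_le hz1
      (le_iSup₂ (f := fun (k : ℂ) (_ : k ∈ spectrum ℂ (matrixB G)) => (‖k‖₊ : ENNReal)) z
        ((hspec z (by exact_mod_cast hz1)).1 hzK))
  exact ⟨le_antisymm
    (spectralRadius_le_of_forall_one_lt hB.le fun z hz => (hspec z hz).1)
    (spectralRadius_le_of_forall_one_lt hK.le fun z hz => (hspec z hz).2), hK⟩
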